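/- An \emph{SPS lattice} is a finite lattice that is slim (it has no sublattice isomorphic to $\mathsf{M}_3$), planar (it has a planar Hasse diagram, with coverings drawn as straight line segments), and (upper) semimodular. Write an interval as $\mathfrak{p}=[0_{\mathfrak p},1_{\mathfrak p}]$; it is \emph{prime} if $1_{\mathfrak p}$ covers $0_{\mathfrak p}$. For intervals $I,J$ of a lattice: - $I$ is \emph{down-perspective} to $J$ if $0_I\vee 1_J=1_I$ and $0_I\wedge 1_J=0_J$. - For prime intervals, $\mathfrak p$ is \emph{prime-perspective down} to $\mathfrak q$ if $\mathfrak p$ is down-perspective to $[0_{\mathfrak p}\wedge 1_{\mathfrak q},1_{\mathfrak q}]$ and $\mathfrak q$ is contained in $[0_{\mathfrak p}\wedge 1_{\mathfrak q},1_{\mathfrak q}]$. - With respect to a given planar diagram, a prime interval $\mathfrak p$ \emph{swings} to a prime interval $\mathfrak q$ if $1_{\mathfrak p}=1_{\mathfrak q}$, this element covers at least three elements, and $0_{\mathfrak q}$ is neither the left-most nor the right-most element covered by it. **Lemma.** Let $L$ be an SPS lattice with any planar diagram, and let $\mathfrak p$ and $\mathfrak q$ be distinct prime intervals in $L$. If $\mathfrak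 p$ is prime-perspective down to $\mathfrak q$, then there exists a sequence of pairwise distinct prime intervals $$\mathfrak p=\mathfrak r_0,\mathfrak r_1,\dots,\mathfrak r_n=\mathfrak q$$ such that $\mathfrak r_i$ is down-perspective to or swings to $\mathfrak r_{i+1}$ for $i=0,\dots,n-1$. -/

import Mathlib

/-- A planar (Hasse) diagram of an ordered set: elements are distinct points of the plane, smaller
elements are drawn lower, coverings are drawn as straight line segments, a segment passes through
no element other than its two endpoints, and two different segments meet at most in the point of a
common endpoint. -/
structure PlanarDiagram (L : Type*) [PartialOrder L] where
  pos : L → ℝ × ℝ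
  pos_injective : Function.Injective pos
  height_lt : ∀ ⦃a b : L⦄, a < b → (pos a).2 < (pos b).2
  eq_endpoint_of_mem : ∀ ⦃a b c : L⦄, a ⋖ b → pos c ∈ segment ℝ (pos a) (pos b) → c = a ∨ c = b
  noncrossing : ∀ ⦃a b c d : L⦄, a ⋖ b → c ⋖ d → (a, b) ≠ (c, d) →
    segment ℝ (pos a) (pos b) ∩ segment ℝ (pos c) (pos d) ⊆ pos '' ({a, b} ∩ {c, d})

/-- No three elements generate a sublattice `M₃`: three distinct elements with equal pairwise meets
`o` and equal pairwise joins `i` are exactly the atoms of a five-element sublattice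
`{o, a, b, c, i}` isomorphic to `M₃`. -/
def IsSlimLattice (L : Type*) [Lattice L] : Prop :=
  ¬ ∃ a b c : L, a ≠ b ∧ b ≠ c ∧ a ≠ c ∧
    a ⊓ b = b ⊓ c ∧ b ⊓ c = a ⊓ c ∧ a ⊔ b = b ⊔ c ∧ b ⊔ c = a ⊔ c

/-- SPS lattices: slim, planar, semimodular (finite) lattices. Semimodular means upper semimodular:
if `a ⊓ b` is covered by `a`, then `b` is covered by `a ⊔ b`. -/
structure IsSPSLattice (L : Type*) [Lattice L] : Prop where
  finite : Finite L
  slim : IsSlimLattice L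
  planar : Nonempty (PlanarDiagram L)
  semimodular : IsUpperModularLattice L

namespace PlanarDiagram

variable {L : Type*} [PartialOrder L]

/-- The horizontal displacement per unit of descent of the edge going down from `x` to `u`. For
lower covers `u` of `x`, it increases from left to right. -/
noncomputable def downSlope (D : PlanarDiagram L) (x u : L) : ℝ :=
  ((D.pos u).1 - (D.pos x).1) / ((D.pos x).2 - (D.pos u).2)

/-- `u` is the left-most element covered by `x` in the diagram. -/
def IsLeftmostCovered (D : PlanarDiagram L) (x u : L) : Prop :=
  u ⋖ x ∧ ∀ v : L, v ⋖ x → D.downSlope x u ≤ D.downSlope x v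

/-- `u` is the right-most element covered by `x` in the diagram. -/
def IsRightmostCovered (D : PlanarDiagram L) (x u : L) : Prop :=
  u ⋖ x ∧ ∀ v : L, v ⋖ x → D.downSlope x v ≤ D.downSlope x u

end PlanarDiagram

/-- Intervals `[0_I, 1_I]` are `NonemptyInterval`s, with `I.fst = 0_I` and `I.snd = 1_I`. An
interval is prime if its top covers its bottom. -/
def IsPrimeInterval {L : Type*} [PartialOrder L] (I : NonemptyInterval L) : Prop :=
  I.fst ⋖ I.snd

/-- `I` is down-perspective to `J`: `1_I = 0_I ⊔ 1_J` and `0_J = 0_I ⊓ 1_J`. -/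
def DownPerspective {L : Type*} [Lattice L] (I J : NonemptyInterval L) : Prop :=
  I.fst ⊔ J.snd = I.snd ∧ I.fst ⊓ J.snd = J.fst

/-- The interval `[0_p ⊓ 1_q, 1_q]`. -/
def meetInterval {L : Type*} [Lattice L] (p q : NonemptyInterval L) : NonemptyInterval L :=
  ⟨(p.fst ⊓ q.snd, q.snd), inf_le_right⟩

/-- `p` is prime-perspective down to `q`: `p` is down-perspective to `[0_p ⊓ 1_q, 1_q]`, and `q` is
contained in `[0_p ⊓ 1_q, 1_q]` (the order of `NonemptyInterval` is containment). -/
def PrimePerspectiveDown {L : Type*} [Lattice L] (p q : NonemptyInterval L) : Prop :=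
  DownPerspective p (meetInterval p q) ∧ q ≤ meetInterval p q

/-- `p` swings to `q`, with respect to the planar diagram `D`. -/
def Swings {L : Type*} [Lattice L] (D : PlanarDiagram L) (p q : NonemptyInterval L) : Prop :=
  p.snd = q.snd ∧ 3 ≤ {x : L | x ⋖ q.snd}.encard ∧
    ¬ D.IsLeftmostCovered q.snd q.fst ∧ ¬ D.IsRightmostCovered q.snd q.fst

/-! Write p = [a, b] and q = [c, d]. If c ≤ a, then p is down-perspective to q. Otherwise pick z ≤ a
covering a ⊓ d and set e = c ⊔ z, f = e ⊔ d. By semimodularity f covers both d and e, and [e, f] is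
down-perspective to [c, d]. Either p is prime-perspective down to [e, f], or it is so to [x, f] for
some lower cover x of f above a ⊓ f, and [x, f] swings to [e, f]. As d < f, induction from the top
reaches these intervals (`reflTransGen_primeStep`). The swing is where planarity enters: a lower
cover drawn between two others lies above their meet (`inf_le_of_downSlope_le`), and this keeps e
from being extreme. -/

namespace PlanarDiagram

variable {L : Type*} [PartialOrder L]

/-- The point at height `t` of the line through `pos a` and `pos b`, as a horizontal coordinate. -/
noncomputable def edgeAt (D : PlanarDiagram L) (a b : L) (t : ℝ) : ℝ :=
  (D.pos b).1 + D.downSlope b a * ((D.pos b).2 - t)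

theorem continuous_edgeAt (D : PlanarDiagram L) (a b : L) : Continuous (D.edgeAt a b) := by
  unfold edgeAt
  fun_prop

theorem edgeAt_bot (D : PlanarDiagram L) {a b : L} (h : a < b) :
    D.edgeAt a b (D.pos a).2 = (D.pos a).1 := by
  have := D.height_lt h
  have h' : (D.pos b).2 - (D.pos a).2 ≠ 0 := by linarith
  unfold edgeAt downSlope
  field_simp
  ring

theorem edgeAt_mem_segment (D : PlanarDiagram L) {a b : L} (h : a < b) {t : ℝ}
    (ha : (D.pos a).2 ≤ t) (hb : t ≤ (D.pos b).2) :
    (D.edgeAt a b t, t) ∈ segment ℝ (D.pos a) (D.pos b) := by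
  have := D.height_lt h
  have h' : 0 < (D.pos b).2 - (D.pos a).2 := by linarith
  refine ⟨((D.pos b).2 - t) / ((D.pos b).2 - (D.pos a).2),
    (t - (D.pos a).2) / ((D.pos b).2 - (D.pos a).2),
    div_nonneg (by linarith) h'.le, div_nonneg (by linarith) h'.le, ?_, ?_⟩
  · field_simp
    ring
  · ext
    · simp only [edgeAt, downSlope, Prod.fst_add, Prod.smul_fst, smul_eq_mul]
      field_simp
      ring
    · simp only [Prod.snd_add, Prod.smul_snd, smul_eq_mul]
      field_simp
      ring

/-- Extending a continuous path from `m` up to `u` by the edge from `u` to `f`. -/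
theorem exists_extension (D : PlanarDiagram L) {u f : L} (huf : u ⋖ f) {g : ℝ → ℝ}
    (hg : Continuous g) (hu : g (D.pos u).2 = (D.pos u).1) :
    ∃ g' : ℝ → ℝ, Continuous g' ∧ (∀ t ≤ (D.pos u).2, g' t = g t) ∧
      ∀ t, (D.pos u).2 ≤ t → g' t = D.edgeAt u f t := by
  refine ⟨fun t => if t ≤ (D.pos u).2 then g t else D.edgeAt u f t, ?_, ?_, ?_⟩
  · refine Continuous.if_le hg (D.continuous_edgeAt u f) continuous_id continuous_const ?_
    rintro t rfl
    rw [hu, D.edgeAt_bot huf.lt]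
  · intro t ht
    simp [ht]
  · intro t ht
    rcases ht.eq_or_lt with rfl | ht
    · simp [hu, D.edgeAt_bot huf.lt]
    · simp [not_le.2 ht]

/-- A maximal chain from `m` to `u` is drawn as the graph of a continuous function of the height. -/
theorem exists_path [Finite L] (D : PlanarDiagram L) {m u : L} (hmu : m ≤ u) :
    ∃ g : ℝ → ℝ, Continuous g ∧ g (D.pos m).2 = (D.pos m).1 ∧ g (D.pos u).2 = (D.pos u).1 ∧
      ∀ t, (D.pos m).2 ≤ t → t < (D.pos u).2 → ∃ c d : L, c ⋖ d ∧ m ≤ c ∧ d ≤ u ∧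
        (g t, t) ∈ segment ℝ (D.pos c) (D.pos d) := by
  induction u using WellFoundedLT.induction with
  | ind u ih =>
    rcases hmu.eq_or_lt with rfl | hlt
    · exact ⟨fun _ => (D.pos m).1, continuous_const, rfl, rfl, fun t h1 h2 => by linarith⟩
    · obtain ⟨v, hmv, hvu⟩ := exists_le_covBy_of_lt hlt
      obtain ⟨g, hg, hgm, hgv, hgs⟩ := ih v hvu.lt hmv
      obtain ⟨g', hg', h1, h2⟩ := D.exists_extension hvu hg hgv
      have hmv' : (D.pos m).2 ≤ (D.pos v).2 := by
        rcases hmv.eq_or_lt with rfl | h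
        · exact le_rfl
        · exact (D.height_lt h).le
      refine ⟨g', hg', by rw [h1 _ hmv', hgm], ?_, fun t hmt htu => ?_⟩
      · rw [h2 _ (D.height_lt hvu.lt).le]
        simp [edgeAt]
      · rcases lt_or_ge t (D.pos v).2 with htv | htv
        · obtain ⟨c, d, hcd, hmc, hdv, hs⟩ := hgs t hmt htv
          exact ⟨c, d, hcd, hmc, hdv.trans hvu.le, by rwa [h1 t htv.le]⟩
        · exact ⟨v, u, hvu, hmv, le_rfl, by
            rw [h2 t htv]; exact D.edgeAt_mem_segment hvu.lt htv htu.le⟩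

/-- A path from `m` up to `f` whose last edge is the one from `u`. -/
theorem exists_path_through [Finite L] (D : PlanarDiagram L) {m u f : L} (hmu : m ≤ u)
    (huf : u ⋖ f) :
    ∃ g : ℝ → ℝ, Continuous g ∧ g (D.pos m).2 = (D.pos m).1 ∧
      (∀ t, (D.pos u).2 ≤ t → g t = D.edgeAt u f t) ∧
      ∀ t, (D.pos m).2 ≤ t → t < (D.pos f).2 → ∃ c d : L, c ⋖ d ∧ m ≤ c ∧ c ≤ u ∧
        (d ≤ u ∨ d = f) ∧ (g t, t) ∈ segment ℝ (D.pos c) (D.pos d) := by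
  obtain ⟨g, hg, hgm, hgu, hgs⟩ := D.exists_path hmu
  obtain ⟨g', hg', h1, h2⟩ := D.exists_extension huf hg hgu
  have hmu' : (D.pos m).2 ≤ (D.pos u).2 := by
    rcases hmu.eq_or_lt with rfl | h
    · exact le_rfl
    · exact (D.height_lt h).le
  refine ⟨g', hg', by rw [h1 _ hmu', hgm], h2, fun t hmt htf => ?_⟩
  rcases lt_or_ge t (D.pos u).2 with htu | htu
  · obtain ⟨c, d, hcd, hmc, hdu, hs⟩ := hgs t hmt htu
    exact ⟨c, d, hcd, hmc, hcd.le.trans hdu, Or.inl hdu, by rwa [h1 t htu.le]⟩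
  · exact ⟨u, f, huf, hmu, le_rfl, Or.inr rfl, by
      rw [h2 t htu]; exact D.edgeAt_mem_segment huf.lt htu htf.le⟩

/-- Two edges that share a point below the height of `f`, the first one above `m` and the second
one on a chain through `v ⋖ f`, force `m ≤ v`. -/
theorem le_of_mem_segments (D : PlanarDiagram L) {m v f c d c' d' : L} (hcd : c ⋖ d)
    (hcd' : c' ⋖ d') (hmc : m ≤ c) (hcv : c' ≤ v) (hdv : d' ≤ v ∨ d' = f) {P : ℝ × ℝ}
    (hP : P ∈ segment ℝ (D.pos c) (D.pos d)) (hP' : P ∈ segment ℝ (D.pos c') (D.pos d'))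
    (hPf : P.2 < (D.pos f).2) : m ≤ v := by
  by_cases heq : (c, d) = (c', d')
  · obtain ⟨rfl, rfl⟩ := Prod.mk.inj heq
    exact hmc.trans hcv
  obtain ⟨y, ⟨hy, hy'⟩, rfl⟩ := D.noncrossing hcd hcd' heq ⟨hP, hP'⟩
  have hmy : m ≤ y := by
    rcases hy with rfl | rfl
    · exact hmc
    · exact hmc.trans hcd.le
  rcases hy' with rfl | rfl
  · exact hmy.trans hcv
  · rcases hdv with h | rfl
    · exact hmy.trans h
    · exact absurd hPf (lt_irrefl _)

end PlanarDiagram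

/-- Continuous functions that do not meet on an interval keep their order. -/
theorem lt_left_of_forall_ne {f g : ℝ → ℝ} (hf : Continuous f) (hg : Continuous g) {a b : ℝ}
    (hab : a ≤ b) (hne : ∀ t ∈ Set.Icc a b, f t ≠ g t) (hb : f b ≤ g b) : f a < g a := by
  by_contra! h
  obtain ⟨t, ht, hft⟩ := intermediate_value_Icc' hab (hf.sub hg).continuousOn
    (show (0 : ℝ) ∈ Set.Icc (f b - g b) (f a - g a) from ⟨by linarith, by linarith⟩)
  exact hne t ht (sub_eq_zero.1 hft)

/-- In a planar lattice, if `u`, `v`, `w` are covered by `f` and `v` is drawn between `u` and `w`,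
then `u ⊓ w ≤ v`. -/
theorem PlanarDiagram.inf_le_of_downSlope_le {L : Type*} [Lattice L] [Finite L]
    (D : PlanarDiagram L) {u v w f : L} (hu : u ⋖ f) (hv : v ⋖ f) (hw : w ⋖ f)
    (huv : D.downSlope f u ≤ D.downSlope f v) (hvw : D.downSlope f v ≤ D.downSlope f w) :
    u ⊓ w ≤ v := by
  by_contra hm
  set m := u ⊓ w with hmdef
  obtain ⟨l, hl, hlm, hlu, hls⟩ := D.exists_path_through (inf_le_left : m ≤ u) hu
  obtain ⟨r, hr, hrm, hrw, hrs⟩ := D.exists_path_through (inf_le_right : m ≤ w) hw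
  -- Starting at `v ⊓ m`, strictly below `m`, the path through `v` is defined at every height where
  -- the other two are.
  obtain ⟨g, hg, -, hgv, hgs⟩ := D.exists_path_through (inf_le_left : v ⊓ m ≤ v) hv
  have hvm : (D.pos (v ⊓ m)).2 < (D.pos m).2 :=
    D.height_lt (lt_of_le_of_ne inf_le_right fun h => hm (inf_eq_right.1 h))
  have hmf : (D.pos m).2 < (D.pos f).2 := D.height_lt (inf_le_left.trans_lt hu.lt)
  -- At height `s` all three paths are on their last edges, so the slopes at `f` give their order.
  obtain ⟨s, hs, hsf⟩ := exists_between (max_lt (max_lt (D.height_lt hu.lt) (D.height_lt hv.lt))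
    (max_lt (D.height_lt hw.lt) hmf))
  simp only [max_lt_iff] at hs
  obtain ⟨⟨hus, hvs⟩, hws, hms⟩ := hs
  have key : ∀ k : ℝ → ℝ, (∀ t, (D.pos m).2 ≤ t → t < (D.pos f).2 → ∃ c d : L, c ⋖ d ∧ m ≤ c ∧
      (k t, t) ∈ segment ℝ (D.pos c) (D.pos d)) → ∀ t ∈ Set.Icc (D.pos m).2 s, k t ≠ g t := by
    rintro k hk t ⟨hmt, hts⟩ hkg
    obtain ⟨c, d, hcd, hmc, hP⟩ := hk t hmt (hts.trans_lt hsf)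
    obtain ⟨c', d', hcd', -, hcv, hdv, hP'⟩ := hgs t (hvm.le.trans hmt) (hts.trans_lt hsf)
    rw [hkg] at hP
    exact hm (D.le_of_mem_segments hcd hcd' hmc hcv hdv hP hP' (hts.trans_lt hsf))
  have h1 := lt_left_of_forall_ne hl hg hms.le (key l fun t h h' => by
    obtain ⟨c, d, hcd, hmc, -, -, hP⟩ := hls t h h'
    exact ⟨c, d, hcd, hmc, hP⟩) (by
      rw [hlu s hus.le, hgv s hvs.le, edgeAt, edgeAt]
      gcongr)
  have h2 := lt_left_of_forall_ne hg hr hms.le (fun t ht => (key r (fun t h h' => by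
    obtain ⟨c, d, hcd, hmc, -, -, hP⟩ := hrs t h h'
    exact ⟨c, d, hcd, hmc, hP⟩) t ht).symm) (by
      rw [hrw s hws.le, hgv s hvs.le, edgeAt, edgeAt]
      gcongr)
  -- At the height of `m` the path `g` would lie strictly between `l` and `r`, which both pass
  -- through `m`.
  linarith

/-- A walk along a relation can be shortened to one without repetitions. -/
theorem exists_injective_of_reflTransGen {α : Type*} {R : α → α → Prop} {p q : α}
    (h : Relation.ReflTransGen R p q) :
    ∃ (n : ℕ) (r : Fin (n + 1) → α), Function.Injective r ∧ r 0 = p ∧ r (Fin.last n) = q ∧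
      ∀ i : Fin n, R (r i.castSucc) (r i.succ) := by
  induction h with
  | refl => exact ⟨0, fun _ => p, fun _ _ _ => Fin.ext (by omega), rfl, rfl, fun i => i.elim0⟩
  | @tail q s _ hqs ih =>
    obtain ⟨n, r, hinj, h0, hl, hr⟩ := ih
    by_cases hmem : s ∈ Set.range r
    · obtain ⟨k, rfl⟩ := hmem
      -- The new endpoint was already visited, so the walk is cut at that visit.
      have hk : (k : ℕ) + 1 ≤ n + 1 := k.2
      refine ⟨k, fun i => r (Fin.castLE hk i), hinj.comp (Fin.castLE_injective hk), h0, rfl,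
        fun i => ?_⟩
      exact hr ⟨i, by omega⟩
    · refine ⟨n + 1, Fin.snoc r s, Fin.snoc_injective_of_injective hinj hmem, ?_, by simp, ?_⟩
      · rw [← Fin.castSucc_zero, Fin.snoc_castSucc, h0]
      · intro i
        induction i using Fin.lastCases with
        | last =>
          rw [Fin.snoc_castSucc, Fin.succ_last, Fin.snoc_last, hl]
          exact hqs
        | cast i =>
          rw [Fin.snoc_castSucc, Fin.succ_castSucc, Fin.snoc_castSucc]
          exact hr i

/-- The steps between prime intervals: down-perspectivities and swings. -/
def PrimeStep {L : Type*} [Lattice L] (D : PlanarDiagram L) (r s : NonemptyInterval L) : Prop :=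
  IsPrimeInterval s ∧ (DownPerspective r s ∨ Swings D r s)

/-- If `e` is covered by `f`, together with `d` and `x`, and if `e` is the join of an element below
`d` and an element below `x`, then every prime interval `[y, f]` swings to `[e, f]`. -/
theorem swings_of_sup_eq {L : Type*} [Lattice L] [Finite L] (D : PlanarDiagram L)
    {c d e f x y z : L} (hd : d ⋖ f) (he : e ⋖ f) (hx : x ⋖ f) (hcd : c ≤ d) (hzx : z ≤ x)
    (hcx : ¬ c ≤ x) (hzd : ¬ z ≤ d) (hcz : c ⊔ z = e) (hy : y ≤ f) :
    Swings D ⟨(y, f), hy⟩ ⟨(e, f), he.le⟩ := by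
  have hce : c ≤ e := hcz ▸ le_sup_left
  have hze : z ≤ e := hcz ▸ le_sup_right
  refine ⟨rfl, ?_, ?_, ?_⟩
  · have hdx : d ≠ x := fun h => hcx (h ▸ hcd)
    have hde : d ≠ e := fun h => hzd (h ▸ hze)
    have hex : e ≠ x := fun h => hcx (h ▸ hce)
    have h3 : ({d, e, x} : Set L).encard = 3 := Set.encard_eq_three.2 ⟨d, e, x, hde, hdx, hex, rfl⟩
    rw [← h3]
    apply Set.encard_le_encard
    rintro _ (rfl | rfl | rfl)
    exacts [hd, he, hx]
  · rintro ⟨-, hleft⟩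
    -- With `e` extreme, `d` or `x` lies between the other two, hence above `e ⊓ x ∋ z` or `e ⊓ d ∋
    -- c` respectively.
    rcases le_total (D.downSlope f d) (D.downSlope f x) with h | h
    · exact hzd ((le_inf hze hzx).trans (D.inf_le_of_downSlope_le he hd hx (hleft d hd) h))
    · exact hcx ((le_inf hce hcd).trans (D.inf_le_of_downSlope_le he hx hd (hleft x hx) h))
  · rintro ⟨-, hright⟩
    rcases le_total (D.downSlope f d) (D.downSlope f x) with h | h
    · exact hcx ((le_inf hcd hce).trans (D.inf_le_of_downSlope_le hd hx he h (hright x hx)))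
    · exact hzd ((le_inf hzx hze).trans (D.inf_le_of_downSlope_le hx hd he h (hright d hd)))

/-- The two hypotheses on `d` unfold prime-perspectivity. Quantifying over `c` inside the induction
lets it apply to any lower cover of a larger top. -/
theorem reflTransGen_primeStep {L : Type*} [Lattice L] [Finite L] [IsUpperModularLattice L]
    (D : PlanarDiagram L) {a b : L} (hab : a ⋖ b) (d : L) :
    ∀ (c : L) (hcd : c ⋖ d), a ⊔ d = b → a ⊓ d ≤ c →
      Relation.ReflTransGen (PrimeStep D) ⟨(a, b), hab.le⟩ ⟨(c, d), hcd.le⟩ := by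
  induction d using WellFoundedGT.induction with
  | ind d ih =>
    intro c hcd hsup hinf
    by_cases hca : c ≤ a
    · exact .single ⟨hcd, Or.inl ⟨hsup, hinf.antisymm (le_inf hca hcd.le)⟩⟩
    have hdb : d ≤ b := hsup ▸ le_sup_right
    -- Otherwise `a < c < d ≤ b`, against `a ⋖ b`.
    have hza : a ⊓ d < a := by
      refine lt_of_le_of_ne inf_le_left fun h => ?_
      exact hab.2 (lt_of_le_not_ge (h ▸ hinf) hca) (hcd.lt.trans_le hdb)
    obtain ⟨z, hz, hza⟩ := exists_covBy_le_of_lt hza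
    have hzd : ¬ z ≤ d := fun h => hz.lt.not_ge (le_inf hza h)
    have hzc : z ⊓ c = a ⊓ d :=
      le_antisymm (inf_le_inf hza hcd.le) (le_inf hz.le hinf)
    have hce : c ⋖ c ⊔ z := by
      rw [sup_comm]
      exact IsUpperModularLattice.covBy_sup_of_inf_covBy (by rwa [hzc])
    obtain ⟨e, hcz⟩ : ∃ e, c ⊔ z = e := ⟨_, rfl⟩
    rw [hcz] at hce
    have hze : z ≤ e := hcz ▸ le_sup_right
    have hed : e ⊓ d = c := by
      refine (hcd.eq_or_eq (le_inf hce.le hcd.le) inf_le_right).resolve_right fun h => ?_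
      rcases hce.eq_or_eq hcd.le (inf_eq_right.1 h) with h' | h'
      · exact hcd.lt.ne' h'
      · exact hzd (h' ▸ hze)
    have hdf : d ⋖ e ⊔ d := IsUpperModularLattice.covBy_sup_of_inf_covBy (by rwa [hed])
    have hef : e ⋖ e ⊔ d := by
      rw [sup_comm]
      exact IsUpperModularLattice.covBy_sup_of_inf_covBy (by rwa [inf_comm, hed])
    have hdown : PrimeStep D ⟨(e, e ⊔ d), hef.le⟩ ⟨(c, d), hcd.le⟩ := ⟨hcd, Or.inl ⟨rfl, hed⟩⟩
    have hfb : e ⊔ d ≤ b :=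
      sup_le (hcz ▸ sup_le (hcd.le.trans hdb) (hza.trans hab.le)) hdb
    have hfsup : a ⊔ (e ⊔ d) = b :=
      le_antisymm (sup_le hab.le hfb) (hsup ▸ sup_le_sup_left le_sup_right a)
    by_cases hte : a ⊓ (e ⊔ d) ≤ e
    · exact (ih _ hdf.lt e hef hfsup hte).tail hdown
    have htf : a ⊓ (e ⊔ d) < e ⊔ d :=
      lt_of_le_of_ne inf_le_right fun h =>
        hab.lt.not_ge (hfsup ▸ sup_le le_rfl (inf_eq_right.1 h))
    -- Here [e, f] is out of reach of the induction, but [x, f] is not, and the swing replaces `x`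
    -- by `e`.
    obtain ⟨x, htx, hxf⟩ := exists_le_covBy_of_lt htf
    have hzx : z ≤ x := (le_inf hza (hze.trans le_sup_left)).trans htx
    have hcx : ¬ c ≤ x := fun h => by
      rcases hef.eq_or_eq (hcz ▸ sup_le h hzx : e ≤ x) hxf.le with h' | h'
      · exact hte (h' ▸ htx)
      · exact hxf.lt.ne h'
    exact ((ih _ hdf.lt x hxf hfsup htx).tail
      (show PrimeStep D ⟨(x, e ⊔ d), hxf.le⟩ ⟨(e, e ⊔ d), hef.le⟩ from
        ⟨hef, Or.inr (swings_of_sup_eq D hdf hef hxf hcd.le hzx hcx hzd hcz hxf.le)⟩)).tail hdown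

theorem lemma4p1 {L : Type*} [Lattice L] (hL : IsSPSLattice L) (D : PlanarDiagram L)
    (p q : NonemptyInterval L) (hp : IsPrimeInterval p) (hq : IsPrimeInterval q) (hpq : p ≠ q)
    (h : PrimePerspectiveDown p q) :
    ∃ (n : ℕ) (r : Fin (n + 1) → NonemptyInterval L),
      (∀ i, IsPrimeInterval (r i)) ∧ Function.Injective r ∧ r 0 = p ∧ r (Fin.last n) = q ∧
        ∀ i : Fin n, DownPerspective (r i.castSucc) (r i.succ) ∨
          Swings D (r i.castSucc) (r i.succ) := by
  have := hL.finite
  have := hL.semimodular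
  obtain ⟨⟨a, b⟩, hab⟩ := p
  obtain ⟨⟨c, d⟩, hcd⟩ := q
  obtain ⟨⟨hsup, -⟩, hinf, -⟩ := h
  obtain ⟨n, r, hinj, h0, hlast, hr⟩ :=
    exists_injective_of_reflTransGen (reflTransGen_primeStep D hp d c hq hsup hinf)
  refine ⟨n, r, fun i => ?_, hinj, h0, hlast, fun i => (hr i).2⟩
  -- `PrimeStep` records primality of the target only, so the initial interval is treated
  -- separately.
  induction i using Fin.cases with
  | zero => rwa [h0]
  | succ i => exact (hr i).1
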